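/- An entire function $f$ has finite order if there is a real number $N>0$ such that $\log|f(z)|<|z|^{N}$ for all sufficiently large $|z|$; the order of $f$ is then the infimum of all such $N>0$. Let $f$ be an entire function of finite order, with order less than $2$, that is real on the real axis and has only real, simple zeros. Then for every integer $n\ge 0$ such that $f^{(n)}$ is not constant (where $f^{(0)}=f$): $f^{(n)}$ is real on the real axis; all zeros of $f^{(n+1)}$ are real and simple; if $a<b$ are consecutive real zeros of $f^{(n)}$, then $f^{(n+1)}$ has exactly one zero in $(a,b)$; every local maximum of the real function $x\mapsto f^{(n)}(x)$, $x\in\mathbb{R}$, is positive, and every local minimum of it is negative. -/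

import Mathlib

open Filter Set

noncomputable section

/-- The numbers `N > 0` such that `log |f z| < |z| ^ N` for all sufficiently large `z`.
(At a zero of `f`, where the inequality is meant to hold, `Real.log 0 = 0 < |z| ^ N` for `z ≠ 0`.) -/
def growthExponents (f : ℂ → ℂ) : Set ℝ :=
  {N : ℝ | 0 < N ∧ ∀ᶠ z : ℂ in Bornology.cobounded ℂ, Real.log ‖f z‖ < ‖z‖ ^ N}

/-- `f` has finite order if some `N > 0` is a growth exponent of `f`. -/
def HasFiniteOrder (f : ℂ → ℂ) : Prop :=
  (growthExponents f).Nonempty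

/-- The order of a function of finite order: the infimum of its growth exponents. -/
def growthOrder (f : ℂ → ℂ) : ℝ :=
  sInf (growthExponents f)

/-- `f` is a constant function. -/
def IsConstantFun (f : ℂ → ℂ) : Prop :=
  ∃ c : ℂ, ∀ z : ℂ, f z = c

/-- `a < b` are consecutive real zeros of `f`. -/
def AreConsecutiveZeros (f : ℂ → ℂ) (a b : ℝ) : Prop :=
  a < b ∧ f a = 0 ∧ f b = 0 ∧ ∀ x ∈ Ioo a b, f (x : ℂ) ≠ 0

end

open Complex Metric Topology

/-! Real entire functions of order below 2 with only real simple zeros are stable under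
differentiation because (f'/f)' behaves like -∑ 1/(z - a)² over the zeros a. In place of Hadamard's
product, f is written as P g, where P carries the zeros in a disc of radius R; Borel–Carathéodory
bounds (g'/g)' near the centre by about R^(N-2), hence by any ε
(`exists_prod_mul_deriv_logDeriv_le`).

If f has a zero, Im (f'/f) has the sign opposite to Im z off the axis, so critical points are real.
On the axis f'/f decreases between zeros and f f'' < 0 at critical points: this yields uniqueness
after Rolle, simplicity, and the signs of extrema. A zero-free f satisfies f' = c f, so it has no
critical point unless constant. -/

/-! ### Factoring out zeros and bounding the zero-free factor. -/

/-- A zero-free function of moderate size on a disc has a logarithm whose second derivative is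
controlled on a smaller disc. -/
theorem norm_deriv_logDeriv_le {g : ℂ → ℂ} (hg : Differentiable ℂ g) {b : ℂ} {R A : ℝ} (hR : 0 < R)
    (hA : 0 < A) (hne : ∀ z ∈ ball b R, g z ≠ 0)
    (hbd : ∀ z ∈ ball b R, ‖g z‖ ≤ ‖g b‖ * Real.exp A) {z : ℂ} (hz : z ∈ ball b (R / 4)) :
    ‖deriv (logDeriv g) z‖ ≤ 64 * A / R ^ 2 := by
  have hld : DifferentiableOn ℂ (logDeriv g) (ball b R) := by
    intro w hw
    exact ((hg.deriv w).div (hg w) (hne w hw)).differentiableWithinAt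
  obtain ⟨h, hh⟩ := hld.isExactOn_ball
  have hbb : b ∈ ball b R := mem_ball_self hR
  have hexp : ∀ w ∈ ball b R, g w = g b * exp (h w - h b) := by
    have hd : ∀ w ∈ ball b R, HasDerivAt (fun w => g w * exp (-h w)) 0 w := by
      intro w hw
      have := (hg w).hasDerivAt.mul ((hh w hw).neg.cexp)
      refine this.congr_deriv ?_
      have := hne w hw
      rw [logDeriv_apply]
      field_simp
      ring
    intro w hw
    have := isOpen_ball.is_const_of_deriv_eq_zero (convex_ball b R).isPreconnected
      (fun w hw => (hd w hw).differentiableAt.differentiableWithinAt)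
      (fun w hw => (hd w hw).deriv) hw hbb
    rw [exp_sub, mul_div_assoc', eq_div_iff (exp_ne_zero _)]
    rw [exp_neg, exp_neg] at this
    field_simp at this
    linear_combination this
  -- Re (h - h b) ≤ A on the large disc; Borel–Carathéodory gives 2Ar/(R - r) ≤ 2A for r < R/2.
  have hbc : ∀ w ∈ ball b (R / 2), ‖h w - h b‖ ≤ 2 * A := by
    intro w hw
    have hw' : ‖w - b‖ < R / 2 := by simpa [dist_eq_norm] using hw
    have hmem : ∀ x ∈ ball (0 : ℂ) R, x + b ∈ ball b R := by
      intro x hx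
      simpa [dist_eq_norm] using hx
    have := borelCaratheodory_zero (f := fun x => h (x + b) - h b) (M := A) (R := R) (z := w - b) hA
      (by
        intro x hx
        exact (((hh _ (hmem x hx)).comp_add_const x b).sub_const
          _).differentiableAt.differentiableWithinAt)
      (by
        intro x hx
        have h1 := hbd _ (hmem x hx)
        rw [hexp _ (hmem x hx), norm_mul, norm_exp] at h1
        have h2 := le_of_mul_le_mul_left h1 (norm_pos_iff.2 (hne b hbb))
        exact Real.exp_le_exp.1 h2)
      hR (by rw [mem_ball_zero_iff]; linarith) (by simp)
    simp only [sub_add_cancel] at this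
    refine this.trans ?_
    rw [div_le_iff₀ (by linarith)]
    nlinarith
  have hzb : dist z b < R / 4 := hz
  have hsub : closedBall z (R / 4) ⊆ ball b (R / 2) := by
    intro w hw
    have := dist_triangle w z b
    simp only [mem_closedBall, mem_ball] at *
    linarith
  have hsub' : ball b (R / 2) ⊆ ball b R := ball_subset_ball (by linarith)
  have hdd : deriv (logDeriv g) z = iteratedDeriv 2 (fun w => h w - h b) z := by
    rw [iteratedDeriv_succ, iteratedDeriv_one]
    apply Filter.EventuallyEq.deriv_eq
    filter_upwards [isOpen_ball.mem_nhds (hsub' (hsub (mem_closedBall_self (by linarith))))] with w hw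
    exact ((hh w hw).sub_const _).deriv.symm
  rw [hdd]
  -- Cauchy's estimate: 2! · 2A / (R/4)² = 64A/R².
  have := norm_iteratedDeriv_le_of_forall_mem_sphere_norm_le (c := z) (R := R / 4) (C := 2 * A)
    (f := fun w => h w - h b) 2 (by linarith)
    (DifferentiableOn.diffContOnCl_ball (U := ball b R) (fun w hw =>
      ((hh w hw).sub_const _).differentiableAt.differentiableWithinAt) (hsub.trans hsub'))
    (fun w hw => hbc w (hsub (sphere_subset_closedBall hw)))
  refine this.trans (le_of_eq ?_)
  simp [Nat.factorial]
  field_simp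
  ring

/-- Dividing an entire function by the linear factors of finitely many of its zeros. -/
theorem exists_eq_prod_sub_mul {f : ℂ → ℂ} (hf : Differentiable ℂ f) (S : Finset ℂ)
    (hS : ∀ a ∈ S, f a = 0) :
    ∃ g : ℂ → ℂ, Differentiable ℂ g ∧ ∀ z, f z = (∏ a ∈ S, (z - a)) * g z := by
  classical
  induction S using Finset.induction_on with
  | empty => exact ⟨f, hf, by simp⟩
  | insert a S ha ih =>
    obtain ⟨g, hg, hfg⟩ := ih fun x hx => hS x (Finset.mem_insert_of_mem hx)
    have hga : g a = 0 := by
      have h1 := hfg a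
      rw [hS a (Finset.mem_insert_self a S)] at h1
      refine (mul_eq_zero.1 h1.symm).resolve_left ?_
      refine Finset.prod_ne_zero_iff.2 fun x hx hax => ?_
      rw [sub_eq_zero] at hax
      exact ha (hax ▸ hx)
    refine ⟨dslope g a, ?_, ?_⟩
    · rw [← differentiableOn_univ, differentiableOn_dslope univ_mem, differentiableOn_univ]
      exact hg
    · intro z
      have := sub_smul_dslope g a z
      rw [hga, sub_zero, smul_eq_mul] at this
      rw [Finset.prod_insert ha, hfg z, ← this]
      ring

theorem finite_zeros_closedBall {f : ℂ → ℂ} (hf : Differentiable ℂ f) {b : ℂ} (hb : f b ≠ 0)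
    (c : ℂ) (R : ℝ) : {z ∈ closedBall c R | f z = 0}.Finite := by
  by_contra hinf
  obtain ⟨x, -, hx⟩ := Set.Infinite.exists_accPt_of_subset_isCompact hinf (isCompact_closedBall c R)
    (fun z hz => hz.1)
  have hfreq : ∃ᶠ z in 𝓝[≠] x, f z = (fun _ => (0 : ℂ)) z :=
    (accPt_iff_frequently_nhdsNE.1 hx).mono fun z hz => hz.2
  have := AnalyticOnNhd.eqOn_of_preconnected_of_frequently_eq (U := univ)
    (fun z _ => hf.analyticAt z) (fun z _ => analyticAt_const) isPreconnected_univ (mem_univ x) hfreq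
  exact hb (this (mem_univ b))

/-- The place where order below 2 is decisive: the main term is of size R^(N-2). -/
theorem eventually_rpow_add_div_sq_le {N : ℝ} (hN : N < 2) (L : ℝ) {ε : ℝ} (hε : 0 < ε) :
    ∀ᶠ R : ℝ in atTop, 64 * ((3 * R) ^ N + L) / R ^ 2 ≤ ε := by
  have h1 : Tendsto (fun R : ℝ => 64 * 3 ^ N * R ^ (-(2 - N)) + 64 * L * R ^ (-(2 : ℝ))) atTop
      (𝓝 (64 * 3 ^ N * 0 + 64 * L * 0)) :=
    ((tendsto_rpow_neg_atTop (by linarith)).const_mul _).add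
      ((tendsto_rpow_neg_atTop (by norm_num)).const_mul _)
  rw [mul_zero, mul_zero, add_zero] at h1
  filter_upwards [h1.eventually (gt_mem_nhds hε), eventually_gt_atTop 0] with R hR hpos
  refine le_trans (le_of_eq ?_) hR.le
  have e2 : R ^ (-(2 : ℝ)) = (R ^ 2)⁻¹ := by rw [Real.rpow_neg hpos.le, Real.rpow_two]
  have e1 : R ^ (-(2 - N)) = R ^ N * (R ^ 2)⁻¹ := by
    rw [← e2, ← Real.rpow_add hpos]; congr 1; ring
  rw [e1, e2, Real.mul_rpow (by norm_num) hpos.le]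
  field_simp

/-- An entire function of order less than two with simple zeros is, on a large disc, a polynomial
times a zero-free function whose logarithm has small second derivative. -/
theorem exists_prod_mul_deriv_logDeriv_le {f : ℂ → ℂ} (hf : Differentiable ℂ f) {N : ℝ}
    (hN0 : 0 < N) (hN : N < 2)
    (hgr : ∀ᶠ z : ℂ in Bornology.cobounded ℂ, ‖f z‖ ≤ Real.exp (‖z‖ ^ N))
    (hs : ∀ z, f z = 0 → deriv f z ≠ 0) {b : ℂ} (hb : f b ≠ 0) (r : ℝ) {ε : ℝ} (hε : 0 < ε) :
    ∃ (S : Finset ℂ) (g : ℂ → ℂ), Differentiable ℂ g ∧ (∀ z, f z = (∏ a ∈ S, (z - a)) * g z) ∧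
      (∀ a ∈ S, f a = 0) ∧
      ∀ z ∈ ball b r, g z ≠ 0 ∧ (f z = 0 → z ∈ S) ∧ ‖deriv (logDeriv g) z‖ ≤ ε := by
  classical
  obtain ⟨K, -, hK⟩ := (hasBasis_cobounded_norm (E := ℂ)).eventually_iff.1 hgr
  simp only [mem_ofPred_eq] at hK
  set L : ℝ := |Real.log ‖f b‖| with hL
  obtain ⟨R, hRε, hRK, hRb, hRr, hR0⟩ := ((eventually_rpow_add_div_sq_le hN L hε).and
    ((eventually_ge_atTop (K + ‖b‖)).and ((eventually_ge_atTop ‖b‖).and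
    ((eventually_ge_atTop (4 * r)).and (eventually_gt_atTop (0 : ℝ)))))).exists
  set A : ℝ := (3 * R) ^ N + L with hAdef
  have hA : 0 < A := by positivity
  let S : Finset ℂ := (finite_zeros_closedBall hf hb b R).toFinset
  have hmem : ∀ z, z ∈ S ↔ z ∈ closedBall b R ∧ f z = 0 := fun z => by simp [S]
  obtain ⟨g, hg, hfg⟩ := exists_eq_prod_sub_mul hf S fun a ha => ((hmem a).1 ha).2
  have hgne : ∀ z ∈ ball b R, g z ≠ 0 := by
    intro z hz hgz
    have hfz : f z = 0 := by rw [hfg z, hgz, mul_zero]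
    have hzS : z ∈ S := (hmem z).2 ⟨ball_subset_closedBall hz, hfz⟩
    -- A common zero of P and g would be a multiple zero of f.
    refine hs z hfz ?_
    have h1 : HasDerivAt (fun w => ∏ a ∈ S, (w - a)) (deriv (fun w => ∏ a ∈ S, (w - a)) z) z :=
      DifferentiableAt.hasDerivAt (by fun_prop)
    have h2 := h1.mul (hg z).hasDerivAt
    rw [show f = (fun w => ∏ a ∈ S, (w - a)) * g from funext hfg, h2.deriv, hgz,
      Finset.prod_eq_zero hzS (sub_self z)]
    simp
  have hbd2 : ∀ z ∈ closedBall b (2 * R), ‖g z‖ ≤ ‖g b‖ * Real.exp A := by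
    intro z hz
    refine norm_le_of_forall_mem_frontier_norm_le (U := ball b (2 * R)) isBounded_ball
      hg.diffContOnCl (fun w hw => ?_) (by rwa [closure_ball _ (by positivity)])
    rw [frontier_ball _ (by positivity), mem_sphere_iff_norm] at hw
    -- On the circle of radius 2R every factor has modulus at least R, while at b it is at most R.
    have hprod : ‖∏ a ∈ S, (b - a)‖ ≤ ‖∏ a ∈ S, (w - a)‖ := by
      rw [norm_prod, norm_prod]
      refine Finset.prod_le_prod (fun _ _ => norm_nonneg _) fun a ha => ?_
      have h1 := ((hmem a).1 ha).1
      rw [mem_closedBall_iff_norm'] at h1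
      have h2 := norm_sub_le_norm_sub_add_norm_sub w a b
      rw [norm_sub_rev a b] at h2
      linarith
    have hbpos : 0 < ‖∏ a ∈ S, (b - a)‖ := by
      refine norm_pos_iff.2 fun h => hb ?_
      rw [hfg b, h, zero_mul]
    have hw1 : ‖w‖ ≤ 3 * R := by
      have := norm_le_norm_sub_add w b
      linarith
    have hw2 : K ≤ ‖w‖ := by
      have := norm_sub_le w b
      linarith
    have hfw : ‖f w‖ ≤ Real.exp ((3 * R) ^ N) :=
      (hK hw2).trans (Real.exp_le_exp.2 (Real.rpow_le_rpow (norm_nonneg _) hw1 hN0.le))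
    have hfb : 1 ≤ ‖f b‖ * Real.exp L := by
      have h0 : 0 < ‖f b‖ := norm_pos_iff.2 hb
      nth_rw 1 [← Real.exp_log h0]
      rw [← Real.exp_add, Real.one_le_exp_iff]
      linarith [neg_abs_le (Real.log ‖f b‖)]
    have hkey : ‖∏ a ∈ S, (w - a)‖ * ‖g w‖ ≤ ‖∏ a ∈ S, (b - a)‖ * (‖g b‖ * Real.exp A) := by
      rw [← norm_mul, ← hfg, ← mul_assoc, ← norm_mul, ← hfg, hAdef, Real.exp_add]
      nlinarith [Real.exp_pos ((3 * R) ^ N)]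
    refine le_of_mul_le_mul_left (le_trans ?_ hkey) hbpos
    gcongr
  refine ⟨S, g, hg, hfg, fun a ha => ((hmem a).1 ha).2, fun z hz => ?_⟩
  have hz' : dist z b < r := hz
  have hzR : z ∈ ball b (R / 4) := by
    rw [mem_ball]; linarith
  have hzR' : z ∈ ball b R := ball_subset_ball (by linarith) hzR
  refine ⟨hgne z hzR', fun h => (hmem z).2 ⟨ball_subset_closedBall hzR', h⟩, ?_⟩
  refine le_trans (norm_deriv_logDeriv_le hg hR0 hA hgne (fun w hw => hbd2 w ?_) hzR) hRε
  exact closedBall_subset_closedBall (by linarith) (ball_subset_closedBall hw)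

/-! ### Logarithmic derivative of the factored function. -/

theorem logDeriv_eq_sum_add {f g : ℂ → ℂ} {S : Finset ℂ} (hg : Differentiable ℂ g)
    (hfg : ∀ z, f z = (∏ a ∈ S, (z - a)) * g z) {z : ℂ} (hz : f z ≠ 0) :
    logDeriv f z = ∑ a ∈ S, (z - a)⁻¹ + logDeriv g z := by
  have hne := hz
  rw [hfg z] at hne
  have hP := left_ne_zero_of_mul hne
  rw [show f = fun z => (∏ a ∈ S, (z - a)) * g z from funext hfg,
    logDeriv_mul z hP (right_ne_zero_of_mul hne) (by fun_prop) (hg z),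
    logDeriv_prod (fun a ha => Finset.prod_ne_zero_iff.1 hP a ha) (fun a _ => by fun_prop)]
  congr 1
  refine Finset.sum_congr rfl fun a _ => ?_
  simp [logDeriv_apply]

theorem deriv_logDeriv_eq_sum_add {f g : ℂ → ℂ} {S : Finset ℂ} (hf : Differentiable ℂ f)
    (hg : Differentiable ℂ g) (hfg : ∀ z, f z = (∏ a ∈ S, (z - a)) * g z) {z : ℂ} (hz : f z ≠ 0) :
    deriv (logDeriv f) z = -∑ a ∈ S, ((z - a) ^ 2)⁻¹ + deriv (logDeriv g) z := by
  have hev : logDeriv f =ᶠ[𝓝 z] fun z => ∑ a ∈ S, (z - a)⁻¹ + logDeriv g z := by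
    filter_upwards [hf.continuous.continuousAt.eventually_ne hz] with w hw
    exact logDeriv_eq_sum_add hg hfg hw
  have hne := hz
  rw [hfg z] at hne
  have hP := left_ne_zero_of_mul hne
  have hgz := right_ne_zero_of_mul hne
  have h1 : HasDerivAt (fun z => ∑ a ∈ S, (z - a)⁻¹) (∑ a ∈ S, -((z - a) ^ 2)⁻¹) z := by
    refine HasDerivAt.fun_sum fun a ha => ?_
    have hza := Finset.prod_ne_zero_iff.1 hP a ha
    refine (((hasDerivAt_id z).sub_const a).fun_inv hza).congr_deriv ?_
    simp [neg_div]
  have h2 : DifferentiableAt ℂ (logDeriv g) z := (hg.deriv z).div (hg z) hgz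
  rw [hev.deriv_eq, (h1.fun_add h2.hasDerivAt).deriv, Finset.sum_neg_distrib]

/-- A complex derivative at a real point of a function that is real on the real axis is real. -/
theorem im_deriv_eq_zero {f : ℂ → ℂ} (hf : Differentiable ℂ f) (hr : ∀ x : ℝ, (f x).im = 0)
    (x : ℝ) : (deriv f x).im = 0 := by
  have h1 := (hf x).hasDerivAt.comp_ofReal
  have h2 := imCLM.hasFDerivAt.comp_hasDerivAt x h1
  refine h2.unique ((hasDerivAt_const x (0 : ℝ)).congr_of_eventuallyEq (.of_forall fun t => ?_))
  simpa using hr t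

theorem hasDerivAt_re_ofReal {f : ℂ → ℂ} (hf : Differentiable ℂ f) (x : ℝ) :
    HasDerivAt (fun t : ℝ => (f t).re) (deriv f x).re x :=
  (hf x).hasDerivAt.real_of_complex

/-! ### Critical points of functions in the class. -/

/-- Entire functions of order less than two that are real on the real axis and have only real,
simple zeros. -/
structure RealSimpleZeros (f : ℂ → ℂ) : Prop where
  differentiable : Differentiable ℂ f
  im_eq_zero : ∀ x : ℝ, (f x).im = 0
  zero_real : ∀ z, f z = 0 → z.im = 0
  deriv_ne_zero : ∀ z, f z = 0 → deriv f z ≠ 0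
  growth : ∃ N : ℝ, 0 < N ∧ N < 2 ∧
    ∀ᶠ z : ℂ in Bornology.cobounded ℂ, ‖f z‖ ≤ Real.exp (‖z‖ ^ N)

namespace RealSimpleZeros

variable {f : ℂ → ℂ}

theorem exists_real_ne_zero (h : RealSimpleZeros f) : ∃ b : ℝ, f b ≠ 0 := by
  by_contra! hall
  refine h.deriv_ne_zero (0 : ℝ) (hall 0) ?_
  exact ((h.differentiable _).hasDerivAt.comp_ofReal).unique
    ((hasDerivAt_const (0 : ℝ) (0 : ℂ)).congr_of_eventuallyEq (.of_forall hall))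

theorem eq_ofReal_re (h : RealSimpleZeros f) {z : ℂ} (hz : f z = 0) : z = (z.re : ℂ) :=
  Complex.ext rfl (by simpa using h.zero_real z hz)

theorem apply_eq_ofReal_re (h : RealSimpleZeros f) (x : ℝ) : f x = ((f x).re : ℂ) :=
  Complex.ext rfl (by simpa using h.im_eq_zero x)

/-- All terms of Im ∑ 1/(z - a) have the sign of -Im z. The error g'/g is real at b and varies
slowly, so it cannot cancel them. -/
theorem deriv_ne_zero_of_im_ne_zero (h : RealSimpleZeros f) {a : ℂ} (ha : f a = 0) {z : ℂ}
    (hz : z.im ≠ 0) : deriv f z ≠ 0 := by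
  intro hdz
  obtain ⟨b, hb⟩ := h.exists_real_ne_zero
  obtain ⟨N, hN0, hN, hgr⟩ := h.growth
  have hfz : f z ≠ 0 := fun h0 => hz (h.zero_real z h0)
  have hza : 0 < normSq (z - a) := normSq_pos.2 fun h0 => hfz (by rwa [sub_eq_zero.1 h0])
  have hy : 0 < |z.im| := abs_pos.2 hz
  -- Makes ε‖z - b‖ smaller than the contribution of the single zero a.
  set ε : ℝ := |z.im| / normSq (z - a) / (‖z - b‖ + 1) with hε
  have hεpos : 0 < ε := by positivity
  obtain ⟨S, g, hg, hfg, hS, hball⟩ := exists_prod_mul_deriv_logDeriv_le h.differentiable hN0 hN hgr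
    h.deriv_ne_zero hb (‖z - b‖ + ‖a - b‖ + 1) hεpos
  have hzmem : z ∈ ball (b : ℂ) (‖z - b‖ + ‖a - b‖ + 1) := by
    rw [mem_ball, dist_eq_norm]; linarith [norm_nonneg (a - b)]
  have hamem : a ∈ ball (b : ℂ) (‖z - b‖ + ‖a - b‖ + 1) := by
    rw [mem_ball, dist_eq_norm]; linarith [norm_nonneg (z - b)]
  have hbmem : (b : ℂ) ∈ ball (b : ℂ) (‖z - b‖ + ‖a - b‖ + 1) := mem_ball_self (by positivity)
  have haS : a ∈ S := (hball a hamem).2.1 ha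
  have hb_im : (logDeriv g b).im = 0 := by
    have h1 : logDeriv f b = _ := logDeriv_eq_sum_add hg hfg hb
    have h2 : (logDeriv f b).im = 0 := by
      rw [logDeriv_apply, h.apply_eq_ofReal_re, div_ofReal_im,
        im_deriv_eq_zero h.differentiable h.im_eq_zero, zero_div]
    rw [h1, add_im, im_sum, Finset.sum_eq_zero, zero_add] at h2
    · exact h2
    · intro a' ha'
      simp [inv_im, h.zero_real a' (hS a' ha')]
  have hz_im : (logDeriv g z).im = z.im * ∑ a ∈ S, (normSq (z - a))⁻¹ := by
    have h1 : logDeriv f z = _ := logDeriv_eq_sum_add hg hfg hfz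
    rw [logDeriv_apply, hdz, zero_div] at h1
    have h2 := congrArg Complex.im h1
    rw [add_im, im_sum, zero_im] at h2
    have h3 : ∑ a ∈ S, ((z - a)⁻¹).im = -(z.im * ∑ a ∈ S, (normSq (z - a))⁻¹) := by
      rw [Finset.mul_sum, ← Finset.sum_neg_distrib]
      refine Finset.sum_congr rfl fun a' ha' => ?_
      rw [inv_im, sub_im, h.zero_real a' (hS a' ha'), sub_zero, neg_div, div_eq_mul_inv]
    linarith
  have hmv : ‖logDeriv g z - logDeriv g b‖ ≤ ε * ‖z - b‖ :=
    (convex_ball (b : ℂ) _).norm_image_sub_le_of_norm_deriv_le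
      (fun w hw => (hg.deriv w).div (hg w) (hball w hw).1) (fun w hw => (hball w hw).2.2) hbmem hzmem
  have h4 := (abs_im_le_norm _).trans hmv
  rw [sub_im, hb_im, sub_zero, hz_im, abs_mul] at h4
  have h5 : (normSq (z - a))⁻¹ ≤ |∑ a ∈ S, (normSq (z - a))⁻¹| :=
    (Finset.single_le_sum (f := fun a => (normSq (z - a))⁻¹)
      (fun a' _ => inv_nonneg.2 (normSq_nonneg _)) haS).trans (le_abs_self _)
  have h6 : ε * ‖z - b‖ < |z.im| * (normSq (z - a))⁻¹ := by
    have : |z.im| * (normSq (z - a))⁻¹ = ε * (‖z - b‖ + 1) := by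
      rw [hε, div_mul_cancel₀ _ (by positivity), div_eq_mul_inv]
    rw [this]
    linarith
  have h7 := mul_le_mul_of_nonneg_left h5 hy.le
  linarith

/-- Every term -1/(x - a)² is negative, and the error is at most half of the term of the given zero.
-/
theorem re_deriv_logDeriv_neg (h : RealSimpleZeros f) {a : ℂ} (ha : f a = 0) {x : ℝ}
    (hx : f x ≠ 0) : (deriv (logDeriv f) x).re < 0 := by
  obtain ⟨N, hN0, hN, hgr⟩ := h.growth
  have hxa : x - a.re ≠ 0 := fun h0 => hx (by
    rw [sub_eq_zero.1 h0, ← h.eq_ofReal_re ha, ha])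
  have hpos : 0 < ((x - a.re) ^ 2)⁻¹ := by positivity
  obtain ⟨S, g, hg, hfg, hS, hball⟩ := exists_prod_mul_deriv_logDeriv_le h.differentiable hN0 hN hgr
    h.deriv_ne_zero hx (‖a - x‖ + 1) (half_pos hpos)
  have haS : a ∈ S := (hball a (by rw [mem_ball, dist_eq_norm]; linarith)).2.1 ha
  have hb := (hball x (mem_ball_self (by positivity))).2.2
  rw [deriv_logDeriv_eq_sum_add h.differentiable hg hfg hx, add_re, neg_re, re_sum]
  have h1 : ∀ a' ∈ S, ((((x : ℂ) - a') ^ 2)⁻¹).re = ((x - a'.re) ^ 2)⁻¹ := by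
    intro a' ha'
    rw [h.eq_ofReal_re (hS a' ha')]
    norm_cast
  rw [Finset.sum_congr rfl h1]
  have h2 := Finset.single_le_sum (f := fun a : ℂ => ((x - a.re) ^ 2)⁻¹)
    (fun a' _ => by positivity) haS
  have h3 := (re_le_norm _).trans hb
  linarith

/-- Without zeros the sum is empty, so (f'/f)' is below every ε and f'/f is constant. -/
theorem exists_deriv_eq_mul (h : RealSimpleZeros f) (hne : ∀ z, f z ≠ 0) :
    ∃ c, ∀ z, deriv f z = c * f z := by
  obtain ⟨N, hN0, hN, hgr⟩ := h.growth
  have hd : ∀ z, deriv (logDeriv f) z = 0 := by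
    intro z
    refine norm_le_zero_iff.1 (le_of_forall_pos_le_add fun ε hε => ?_)
    obtain ⟨S, g, hg, hfg, hS, hball⟩ := exists_prod_mul_deriv_logDeriv_le h.differentiable hN0 hN
      hgr h.deriv_ne_zero (hne z) 1 hε
    obtain rfl : S = ∅ := Finset.eq_empty_of_forall_notMem fun a ha => hne a (hS a ha)
    rw [deriv_logDeriv_eq_sum_add h.differentiable hg hfg (hne z)]
    simpa using (hball z (mem_ball_self one_pos)).2.2
  refine ⟨logDeriv f 0, fun z => ?_⟩
  rw [is_const_of_deriv_eq_zero (f := logDeriv f)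
    (fun w => (h.differentiable.deriv w).div (h.differentiable w) (hne w)) hd 0 z, logDeriv_apply,
    div_mul_cancel₀ _ (hne z)]

theorem exists_zero_of_deriv_eq_zero (h : RealSimpleZeros f) (hc : ¬ IsConstantFun f) {z : ℂ}
    (hz : deriv f z = 0) : ∃ a, f a = 0 := by
  by_contra! hne
  obtain ⟨c, hcf⟩ := h.exists_deriv_eq_mul hne
  obtain rfl : c = 0 := (mul_eq_zero.1 ((hcf z).symm.trans hz)).resolve_right (hne z)
  exact hc ⟨f 0, fun w => is_const_of_deriv_eq_zero h.differentiable (fun v => by simp [hcf v]) w 0⟩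

theorem im_eq_zero_of_deriv_eq_zero (h : RealSimpleZeros f) (hc : ¬ IsConstantFun f) {z : ℂ}
    (hz : deriv f z = 0) : z.im = 0 := by
  obtain ⟨a, ha⟩ := h.exists_zero_of_deriv_eq_zero hc hz
  by_contra hne
  exact h.deriv_ne_zero_of_im_ne_zero ha hne hz

/-- At a real critical point, the function and its second derivative have opposite signs. -/
theorem re_mul_re_deriv_deriv_neg (h : RealSimpleZeros f) (hc : ¬ IsConstantFun f) {x : ℝ}
    (hx : deriv f x = 0) : (f x).re * (deriv (deriv f) x).re < 0 := by
  obtain ⟨a, ha⟩ := h.exists_zero_of_deriv_eq_zero hc hx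
  have hfx : f x ≠ 0 := fun h0 => h.deriv_ne_zero x h0 hx
  have h1 := h.re_deriv_logDeriv_neg ha hfx
  have h2 := ((h.differentiable.deriv x).hasDerivAt.div (h.differentiable x).hasDerivAt hfx).deriv
  have h3 : deriv (logDeriv f) x = deriv (deriv f) x / f x := by
    refine Eq.trans h2 ?_
    rw [hx]
    field_simp
    simp
  have hre : (f x).re ≠ 0 := fun h0 => hfx (by rw [h.apply_eq_ofReal_re, h0, ofReal_zero])
  rw [h3, h.apply_eq_ofReal_re, div_ofReal_re] at h1
  have h4 := mul_neg_of_pos_of_neg (pow_pos (abs_pos.2 hre) 2) h1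
  rw [sq_abs] at h4
  calc _ = (f x).re ^ 2 * ((deriv (deriv f) x).re / (f x).re) := by field_simp
    _ < 0 := h4

theorem deriv_deriv_ne_zero (h : RealSimpleZeros f) (hc : ¬ IsConstantFun f) {z : ℂ}
    (hz : deriv f z = 0) : deriv (deriv f) z ≠ 0 := by
  intro h0
  have hzr : z = (z.re : ℂ) :=
    Complex.ext rfl (by simpa using h.im_eq_zero_of_deriv_eq_zero hc hz)
  rw [hzr] at hz h0
  have := h.re_mul_re_deriv_deriv_neg hc hz
  simp [h0] at this

/-- Cauchy's estimate on unit circles; the larger exponent M absorbs the factor 2^N. -/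
theorem growth_deriv (hf : Differentiable ℂ f) {N : ℝ} (hN0 : 0 < N) (hN : N < 2)
    (hgr : ∀ᶠ z : ℂ in Bornology.cobounded ℂ, ‖f z‖ ≤ Real.exp (‖z‖ ^ N)) :
    ∃ M : ℝ, 0 < M ∧ M < 2 ∧
      ∀ᶠ z : ℂ in Bornology.cobounded ℂ, ‖deriv f z‖ ≤ Real.exp (‖z‖ ^ M) := by
  obtain ⟨M, hNM, hM⟩ := exists_between hN
  refine ⟨M, hN0.trans hNM, hM, ?_⟩
  obtain ⟨K, -, hK⟩ := (hasBasis_cobounded_norm (E := ℂ)).eventually_iff.1 hgr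
  simp only [mem_ofPred_eq] at hK
  have hlarge : ∀ᶠ t : ℝ in atTop, (2 : ℝ) ^ N ≤ t ^ (M - N) :=
    (tendsto_rpow_atTop (by linarith)).eventually_ge_atTop _
  have hnorm := tendsto_norm_cobounded_atTop (E := ℂ)
  filter_upwards [hnorm.eventually hlarge, hnorm.eventually_ge_atTop (K + 1),
    hnorm.eventually_ge_atTop 1] with z h1 h2 h3
  have h4 := norm_deriv_le_of_forall_mem_sphere_norm_le (c := z) (R := 1)
    (C := Real.exp (‖z‖ ^ M)) one_pos hf.diffContOnCl (fun w hw => by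
      rw [mem_sphere_iff_norm] at hw
      have hw1 : ‖w‖ ≤ 2 * ‖z‖ := by
        have := norm_le_norm_sub_add w z
        linarith
      have hw2 : K ≤ ‖w‖ := by
        have := norm_sub_norm_le z w
        rw [norm_sub_rev] at this
        linarith
      refine (hK hw2).trans (Real.exp_le_exp.2 ?_)
      calc ‖w‖ ^ N ≤ (2 * ‖z‖) ^ N := Real.rpow_le_rpow (norm_nonneg _) hw1 hN0.le
        _ = 2 ^ N * ‖z‖ ^ N := Real.mul_rpow (by norm_num) (norm_nonneg _)
        _ ≤ ‖z‖ ^ (M - N) * ‖z‖ ^ N := by gcongr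
        _ = ‖z‖ ^ M := by
          rw [← Real.rpow_add (by linarith)]
          congr 1
          ring)
  simpa using h4

protected theorem deriv (h : RealSimpleZeros f) (hc : ¬ IsConstantFun f) :
    RealSimpleZeros (deriv f) where
  differentiable := h.differentiable.deriv
  im_eq_zero := im_deriv_eq_zero h.differentiable h.im_eq_zero
  zero_real _ hz := h.im_eq_zero_of_deriv_eq_zero hc hz
  deriv_ne_zero _ hz := h.deriv_deriv_ne_zero hc hz
  growth := by
    obtain ⟨N, hN0, hN, hgr⟩ := h.growth
    exact growth_deriv h.differentiable hN0 hN hgr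

theorem deriv_eq_zero_iff (h : RealSimpleZeros f) (x : ℝ) :
    deriv f x = 0 ↔ (deriv f x).re = 0 := by
  refine ⟨fun h0 => by rw [h0, zero_re], fun h0 => Complex.ext h0 ?_⟩
  simpa using im_deriv_eq_zero h.differentiable h.im_eq_zero x

theorem existsUnique_deriv_eq_zero (h : RealSimpleZeros f) {a b : ℝ}
    (hab : AreConsecutiveZeros f a b) : ∃! x : ℝ, x ∈ Ioo a b ∧ deriv f x = 0 := by
  obtain ⟨hlt, ha, hb, hne⟩ := hab
  obtain ⟨c, hc, hcd⟩ := exists_hasDerivAt_eq_zero (f := fun t : ℝ => (f t).re)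
    (f' := fun t : ℝ => (deriv f t).re) hlt
    (fun t _ => (hasDerivAt_re_ofReal h.differentiable t).continuousAt.continuousWithinAt)
    (by simp [ha, hb]) (fun t _ => hasDerivAt_re_ofReal h.differentiable t)
  refine ⟨c, ⟨hc, (h.deriv_eq_zero_iff c).2 hcd⟩, ?_⟩
  have hder : ∀ t ∈ Ioo a b, HasDerivAt (fun t : ℝ => (logDeriv f t).re)
      (deriv (logDeriv f) t).re t := fun t ht =>
    (((h.differentiable.deriv t).div (h.differentiable t) (hne t ht)).hasDerivAt).real_of_complex
  -- Rolle gave existence; two zeros of the strictly decreasing f'/f must coincide.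
  have hanti : StrictAntiOn (fun t : ℝ => (logDeriv f t).re) (Ioo a b) := by
    refine strictAntiOn_of_deriv_neg (convex_Ioo a b)
      (fun t ht => (hder t ht).continuousAt.continuousWithinAt) fun t ht => ?_
    rw [interior_Ioo] at ht
    rw [(hder t ht).deriv]
    exact h.re_deriv_logDeriv_neg ha (hne t ht)
  rintro y ⟨hy, hyd⟩
  refine hanti.injOn hy hc ?_
  simp [logDeriv_apply, hyd, (h.deriv_eq_zero_iff c).2 hcd]

end RealSimpleZeros

/-! ### Signs of extrema and iteration. -/

theorem IsLocalMax.not_deriv_deriv_pos {F : ℝ → ℝ} {x : ℝ} (hF : IsLocalMax F x)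
    (hc : ContinuousAt F x) : ¬ 0 < deriv (deriv F) x := by
  intro hpos
  have hmin := isLocalMin_of_deriv_deriv_pos hpos hF.deriv_eq_zero hc
  -- Being both a local maximum and a local minimum forces F to be locally constant.
  have heq : F =ᶠ[𝓝 x] fun _ => F x := by
    filter_upwards [hF, hmin] with t h1 h2 using le_antisymm h1 h2
  rw [heq.deriv.deriv_eq] at hpos
  simp at hpos

namespace RealSimpleZeros

variable {f : ℂ → ℂ}

theorem deriv_deriv_re (hf : Differentiable ℂ f) (x : ℝ) :
    deriv (deriv fun t : ℝ => (f t).re) x = (deriv (deriv f) x).re := by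
  rw [funext fun t => (hasDerivAt_re_ofReal hf t).deriv]
  exact (hasDerivAt_re_ofReal hf.deriv x).deriv

theorem re_pos_of_isLocalMax (h : RealSimpleZeros f) (hc : ¬ IsConstantFun f) {x : ℝ}
    (hx : IsLocalMax (fun t : ℝ => (f t).re) x) : 0 < (f x).re := by
  have hd := hasDerivAt_re_ofReal h.differentiable x
  have h1 := h.re_mul_re_deriv_deriv_neg hc ((h.deriv_eq_zero_iff x).2 (hx.hasDerivAt_eq_zero hd))
  have h2 := hx.not_deriv_deriv_pos hd.continuousAt
  rw [deriv_deriv_re h.differentiable] at h2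
  nlinarith

theorem re_neg_of_isLocalMin (h : RealSimpleZeros f) (hc : ¬ IsConstantFun f) {x : ℝ}
    (hx : IsLocalMin (fun t : ℝ => (f t).re) x) : (f x).re < 0 := by
  have hd := hasDerivAt_re_ofReal h.differentiable x
  have h1 := h.re_mul_re_deriv_deriv_neg hc ((h.deriv_eq_zero_iff x).2 (hx.hasDerivAt_eq_zero hd))
  have h2 := hx.neg.not_deriv_deriv_pos hd.continuousAt.neg
  simp only [deriv.fun_neg', deriv_deriv_re h.differentiable] at h2
  nlinarith

protected theorem iteratedDeriv (h : RealSimpleZeros f) (n : ℕ)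
    (hc : ¬ IsConstantFun (iteratedDeriv n f)) : RealSimpleZeros (iteratedDeriv n f) := by
  induction n with
  | zero => simpa using h
  | succ n ih =>
    have hc' : ¬ IsConstantFun (iteratedDeriv n f) := by
      rintro ⟨c, hcn⟩
      refine hc ⟨0, fun z => ?_⟩
      rw [iteratedDeriv_succ, funext hcn, deriv_const]
    rw [iteratedDeriv_succ]
    exact (ih hc').deriv hc'

end RealSimpleZeros

/-! ### Passage from the stated hypotheses to the class. -/

theorem analyticOrderAt_eq_one_iff_deriv_ne_zero {f : ℂ → ℂ} (hf : Differentiable ℂ f) {z : ℂ}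
    (hz : f z = 0) : analyticOrderAt f z = 1 ↔ deriv f z ≠ 0 := by
  refine ⟨fun h1 => ?_, (hf.analyticAt z).analyticOrderAt_eq_one_of_zero_deriv_ne_zero hz⟩
  have h2 := analyticOrderAt_deriv_of_pos (hf.analyticAt z) (n := 0) (by simpa using h1)
  exact (hf.deriv.analyticAt z).analyticOrderAt_eq_zero.1 (by simpa using h2)

theorem realSimpleZeros_of_growthOrder_lt {f : ℂ → ℂ} (hf : Differentiable ℂ f)
    (hfin : HasFiniteOrder f) (hord : growthOrder f < 2)
    (hreal : ∀ x : ℝ, (f x).im = 0)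
    (hzeros : ∀ z : ℂ, f z = 0 → z.im = 0 ∧ analyticOrderAt f z = 1) : RealSimpleZeros f where
  differentiable := hf
  im_eq_zero := hreal
  zero_real z hz := (hzeros z hz).1
  deriv_ne_zero z hz := (analyticOrderAt_eq_one_iff_deriv_ne_zero hf hz).1 (hzeros z hz).2
  growth := by
    obtain ⟨N, ⟨hN0, hgr⟩, hN⟩ := exists_lt_of_csInf_lt hfin hord
    refine ⟨N, hN0, hN, hgr.mono fun z hz => ?_⟩
    -- At zeros of f the logarithm carries no information, but the bound is trivial.
    rcases (norm_nonneg (f z)).eq_or_lt with h0 | h0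
    · rw [← h0]
      exact (Real.exp_pos _).le
    · exact ((Real.log_lt_iff_lt_exp h0).1 hz).le

theorem theorem6 (f : ℂ → ℂ) (hf : Differentiable ℂ f)
    (hfin : HasFiniteOrder f) (hord : growthOrder f < 2)
    (hreal : ∀ x : ℝ, (f x).im = 0)
    (hzeros : ∀ z : ℂ, f z = 0 → z.im = 0 ∧ analyticOrderAt f z = 1) :
    ∀ n : ℕ, ¬ IsConstantFun (iteratedDeriv n f) →
      -- the derivative of order `n` is real on the real axis
      (∀ x : ℝ, (iteratedDeriv n f x).im = 0) ∧
      -- all zeros of its derivative are real and simple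
      (∀ z : ℂ, iteratedDeriv (n + 1) f z = 0 →
        z.im = 0 ∧ analyticOrderAt (iteratedDeriv (n + 1) f) z = 1) ∧
      -- with exactly one between two consecutive zeros
      (∀ a b : ℝ, AreConsecutiveZeros (iteratedDeriv n f) a b →
        ∃! x : ℝ, x ∈ Ioo a b ∧ iteratedDeriv (n + 1) f x = 0) ∧
      -- local maxima are positive, local minima are negative
      (∀ x : ℝ, IsLocalMax (fun t : ℝ => (iteratedDeriv n f t).re) x →
        0 < (iteratedDeriv n f x).re) ∧
      (∀ x : ℝ, IsLocalMin (fun t : ℝ => (iteratedDeriv n f t).re) x →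
        (iteratedDeriv n f x).re < 0) := by
  intro n hc
  have h := (realSimpleZeros_of_growthOrder_lt hf hfin hord hreal hzeros).iteratedDeriv n hc
  rw [iteratedDeriv_succ]
  have hd := h.deriv hc
  exact ⟨h.im_eq_zero,
    fun z hz => ⟨hd.zero_real z hz,
      (analyticOrderAt_eq_one_iff_deriv_ne_zero hd.differentiable hz).2 (hd.deriv_ne_zero z hz)⟩,
    fun a b hab => h.existsUnique_deriv_eq_zero hab,
    fun x hx => h.re_pos_of_isLocalMax hc hx, fun x hx => h.re_neg_of_isLocalMin hc hx⟩
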